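/- Let $G$ be a finite simple graph with adjacency matrix $A$, and let $u \neq v$ be two non-adjacent vertices of $G$ that have the same neighbourhood, and suppose that this common neighbourhood is non-empty. Then there is a potential $Q : V(G) \to \mathbb{R}$ for which there is perfect state transfer between $u$ and $v$ (in both directions). Here, with $H = A - \operatorname{diag}(Q)$, there is perfect state transfer from $a$ to $b$ if the solution $\varphi : \mathbb{R} \to \mathbb{C}^{V(G)}$ of the discrete Schrödinger equation $\frac{d}{dt}\varphi_t = iH\varphi_t$ with $\varphi_0 = \mathbf{1}_a$ (the indicator function of $a$) satisfies, at some time $T \ge 0$, $|\varphi_T(b)| = 1$ and $\varphi_T(x) = 0$ for all vertices $x \neq b$. -/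

import Mathlib

open scoped Matrix

/-- The Hamiltonian `H = A - Q` of a finite simple graph `G` with a real potential `Q`
on the vertices: `A` is the adjacency matrix, and `Q` is placed on the diagonal. -/
noncomputable def hamiltonian {V : Type*} [Fintype V] [DecidableEq V] (G : SimpleGraph V)
    [DecidableRel G.Adj] (Q : V → ℝ) : Matrix V V ℂ :=
  G.adjMatrix ℂ - Matrix.diagonal (fun x => (Q x : ℂ))

/-- `φ` solves the discrete Schrödinger equation `dφ/dt = i H φ` for `H = A - Q`. -/
def IsSchrodingerSolution {V : Type*} [Fintype V] [DecidableEq V] (G : SimpleGraph V)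
    [DecidableRel G.Adj] (Q : V → ℝ) (φ : ℝ → V → ℂ) : Prop :=
  ∀ t : ℝ, HasDerivAt φ (Complex.I • (hamiltonian G Q *ᵥ φ t)) t

/-- Perfect state transfer from `u` to `v`: the solution of the Schrödinger equation whose
initial value is the indicator function of `u` is, at some time `T`, of modulus one at `v`
and zero at all other vertices. (The equation is linear, so the solution is unique.) -/
def PerfectStateTransfer {V : Type*} [Fintype V] [DecidableEq V] (G : SimpleGraph V)
    [DecidableRel G.Adj] (Q : V → ℝ) (u v : V) : Prop :=
  ∃ φ : ℝ → V → ℂ, IsSchrodingerSolution G Q φ ∧ φ 0 = Pi.single u 1 ∧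
    ∃ T : ℝ, 0 ≤ T ∧ ‖φ T v‖ = 1 ∧ ∀ x : V, x ≠ v → φ T x = 0

/-! Let `Q u = Q v`. The twins' columns cancel, so `e_u - e_v` is an eigenvector of `H` with
eigenvalue `-Q u`, while `e_u + e_v` lies in the invariant space of functions equal at `u` and `v`,
where `H` acts as a quotient matrix. If at time `T` every phase on the second space is `1` and the
phase of `e_u - e_v` is `-1`, then `e_u` evolves to `e_v`, and conversely.

It remains to choose `Q`. Up to the scale `1 / ε`, the quotient of `H` is `D + ε B` with `D`
diagonal. By the implicit function theorem `D` can follow `ε` continuously so that the spectrum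
stays a fixed set of distinct natural numbers, with `D w = 0` at `ε = 0`, where `w` is the merged
vertex. The matrix is positive semidefinite for a weighted inner product, so a zero entry at `w`
would kill its column, which a neighbour of `u` forbids. Hence `D w` becomes positive, and by
continuity it takes a value `1 / (2k)` at some `ε > 0`. Then `T = 2πkε` gives the required phases.
-/

/-! ### Diagonals with prescribed spectrum -/

/-- A continuous branch of solutions of `F (ε, d) = 0` near a zero `(0, a)` where the partial
derivative of `F` in `d` is injective. -/
theorem exists_continuousOn_implicit {E : Type*} [NormedAddCommGroup E] [NormedSpace ℝ E]
    [FiniteDimensional ℝ E] {F : ℝ × E → E} (hF : ContDiff ℝ 1 F) {a : E} (ha : F (0, a) = 0)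
    (hinj : ∀ h : E, fderiv ℝ F (0, a) (0, h) = 0 → h = 0) :
    ∃ δ : ℝ, 0 < δ ∧ ∃ ψ : ℝ → E, ContinuousOn ψ (Set.Icc 0 δ) ∧ ψ 0 = a ∧
      ∀ ε ∈ Set.Icc 0 δ, F (ε, ψ ε) = 0 := by
  have : CompleteSpace E := FiniteDimensional.complete ℝ E
  -- Adjoining the coordinate `ε` to `F` reduces the claim to the inverse function theorem.
  set L : ℝ × E →L[ℝ] ℝ × E := (ContinuousLinearMap.fst ℝ ℝ E).prod (fderiv ℝ F (0, a)) with hL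
  have hLinj : Function.Injective L := by
    rw [injective_iff_map_eq_zero]
    rintro ⟨s, h⟩ hs
    have h1 : s = 0 := congrArg Prod.fst hs
    subst h1
    rw [hinj h (congrArg Prod.snd hs)]
    rfl
  let e : (ℝ × E) ≃L[ℝ] ℝ × E :=
    (LinearEquiv.ofInjectiveEndo (L : ℝ × E →ₗ[ℝ] ℝ × E) hLinj).toContinuousLinearEquiv
  have hΦ : HasStrictFDerivAt (fun p : ℝ × E => (p.1, F p)) (e : ℝ × E →L[ℝ] ℝ × E) (0, a) :=
    hasStrictFDerivAt_fst.prodMk (hF.hasStrictFDerivAt one_ne_zero)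
  let Φ := hΦ.toOpenPartialHomeomorph _
  have hsrc : (0, a) ∈ Φ.source := hΦ.mem_toOpenPartialHomeomorph_source
  have hmem : ((0 : ℝ), (0 : E)) ∈ Φ.target := by
    have := hΦ.image_mem_toOpenPartialHomeomorph_target
    simpa only [ha] using this
  have hcont : Continuous fun ε : ℝ => (ε, (0 : E)) := by fun_prop
  have hnhds : (fun ε : ℝ => (ε, (0 : E))) ⁻¹' Φ.target ∈ nhds (0 : ℝ) :=
    hcont.continuousAt.preimage_mem_nhds (Φ.open_target.mem_nhds hmem)
  obtain ⟨r, hr, hball⟩ := Metric.mem_nhds_iff.1 hnhds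
  have hIcc : ∀ ε ∈ Set.Icc 0 (r / 2), (ε, (0 : E)) ∈ Φ.target := fun ε hε =>
    hball (by rw [Metric.mem_ball, Real.dist_eq, sub_zero, abs_of_nonneg hε.1]; linarith [hε.2])
  have hright : ∀ ε ∈ Set.Icc 0 (r / 2),
      ((Φ.symm (ε, 0)).1, F (Φ.symm (ε, 0))) = (ε, (0 : E)) := fun ε hε =>
    Φ.right_inv (hIcc ε hε)
  refine ⟨r / 2, by positivity, fun ε => (Φ.symm (ε, 0)).2, ?_, ?_, ?_⟩
  · exact continuous_snd.comp_continuousOn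
      (Φ.continuousOn_symm.comp hcont.continuousOn fun ε hε => hIcc ε hε)
  · have h := Φ.left_inv hsrc
    have h2 : Φ (0, a) = (0, 0) := by
      change ((0 : ℝ), F (0, a)) = (0, 0)
      rw [ha]
    rw [h2] at h
    exact congrArg Prod.snd h
  · intro ε hε
    have h := hright ε hε
    have h1 : (Φ.symm (ε, 0)).1 = ε := congrArg Prod.fst h
    have h2 : F (Φ.symm (ε, 0)) = 0 := congrArg Prod.snd h
    have h3 : (ε, (Φ.symm (ε, 0)).2) = Φ.symm (ε, 0) := Prod.ext h1.symm rfl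
    exact (congrArg F h3).trans h2

/-- For small `ε ≥ 0` one can choose the diagonal `ψ ε`, continuously in `ε`, so that
`diagonal (ψ ε) + ε • B` has prescribed distinct eigenvalues. -/
theorem exists_diagonal_prescribed_eigenvalues {n : Type*} [Fintype n] [DecidableEq n]
    (B : Matrix n n ℝ) {a : n → ℝ} (ha : Function.Injective a) :
    ∃ δ : ℝ, 0 < δ ∧ ∃ ψ : ℝ → n → ℝ, ContinuousOn ψ (Set.Icc 0 δ) ∧ ψ 0 = a ∧
      ∀ ε ∈ Set.Icc 0 δ, ∀ i,
        (Matrix.diagonal (fun _ => a i) - (Matrix.diagonal (ψ ε) + ε • B)).det = 0 := by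
  let F : ℝ × (n → ℝ) → n → ℝ := fun p i =>
    (Matrix.diagonal (fun _ => a i) - (Matrix.diagonal p.2 + p.1 • B)).det
  have hF : ContDiff ℝ 1 F := by
    refine contDiff_pi.2 fun i => ?_
    simp only [F, Matrix.det_apply]
    refine ContDiff.sum fun σ _ => ContDiff.const_smul _ (contDiff_prod fun j _ => ?_)
    simp only [Matrix.sub_apply, Matrix.add_apply, Matrix.smul_apply, smul_eq_mul,
      Matrix.diagonal_apply]
    split_ifs <;> fun_prop
  have hF0 : ∀ d i, F (0, d) i = ∏ j, (a i - d j) := by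
    intro d i
    simp only [F, zero_smul, add_zero, Matrix.diagonal_sub, Matrix.det_diagonal]
  have h0 : F (0, a) = 0 := by
    ext i
    rw [hF0]
    exact Finset.prod_eq_zero (Finset.mem_univ i) (sub_self _)
  have hinj : ∀ h : n → ℝ, fderiv ℝ F (0, a) (0, h) = 0 → h = 0 := by
    intro h hh
    ext i
    have hline : HasDerivAt (fun t : ℝ => ((0 : ℝ), a + t • h)) (0, h) 0 := by
      refine (hasDerivAt_const _ _).prodMk ?_
      simpa using ((hasDerivAt_id (0 : ℝ)).smul_const h).const_add a
    have hd : HasFDerivAt F (fderiv ℝ F (0, a)) ((fun t : ℝ => ((0 : ℝ), a + t • h)) 0) := by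
      simpa using (hF.differentiable one_ne_zero).differentiableAt.hasFDerivAt (x := ((0 : ℝ), a))
    have h1 := hasDerivAt_pi.1 (hd.comp_hasDerivAt 0 hline) i
    rw [hh] at h1
    -- At `ε = 0` only the factor `a i - d i` vanishes at `d = a`, so the derivative in `d` is
    -- diagonal with entries `-∏ (a i - a j)` over `j ≠ i`, nonzero because the `a i` are distinct.
    let g : ℝ → ℝ := fun t => ∏ j ∈ Finset.univ.erase i, (a i - (a j + t * h j))
    have hg : DifferentiableAt ℝ g 0 := by
      simp only [g]
      fun_prop
    have h2 : HasDerivAt (fun t : ℝ => -h i * t * g t) (-h i * g 0) 0 := by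
      refine (((hasDerivAt_id (0 : ℝ)).const_mul (-h i)).fun_mul hg.hasDerivAt).congr_deriv ?_
      simp
    have heq : (fun t : ℝ => -h i * t * g t) =
        fun t => (F ∘ fun t : ℝ => ((0 : ℝ), a + t • h)) t i := by
      ext t
      simp only [Function.comp_apply, hF0, Pi.add_apply, Pi.smul_apply, smul_eq_mul]
      rw [← Finset.mul_prod_erase _ _ (Finset.mem_univ i)]
      ring
    rw [heq] at h2
    have h3 := h1.unique h2
    have h4 : g 0 ≠ 0 := by
      refine Finset.prod_ne_zero_iff.2 fun j hj => ?_
      simpa using sub_ne_zero.2 (ha.ne (Finset.ne_of_mem_erase hj).symm)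
    have h5 : -h i * g 0 = 0 := h3.symm
    simpa [h4] using h5
  obtain ⟨δ, hδ, ψ, hψ, hψ0, h⟩ := exists_continuousOn_implicit hF h0 hinj
  exact ⟨δ, hδ, ψ, hψ, hψ0, fun ε hε i => congrFun (h ε hε) i⟩

/-! ### Spectral decomposition and positivity -/

/-- If `det (a i - M) = 0` for as many distinct scalars `a i` as the size of `M`, then every vector
is a sum of eigenvectors of `M` with eigenvalues `a i`. -/
theorem exists_sum_eigenvectors {n : Type*} [Fintype n] [DecidableEq n] (M : Matrix n n ℝ)
    {a : n → ℝ} (ha : Function.Injective a)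
    (hdet : ∀ i, (Matrix.diagonal (fun _ => a i) - M).det = 0) (x : n → ℝ) :
    ∃ p : n → n → ℝ, (∀ i, M *ᵥ p i = a i • p i) ∧ x = ∑ i, p i := by
  have hex : ∀ i, ∃ q : n → ℝ, q ≠ 0 ∧ M *ᵥ q = a i • q := by
    intro i
    obtain ⟨q, hq, h⟩ := Matrix.exists_mulVec_eq_zero_iff.2 (hdet i)
    refine ⟨q, hq, ?_⟩
    rw [Matrix.sub_mulVec, sub_eq_zero] at h
    rw [← h]
    ext j
    simp [Matrix.mulVec_diagonal]
  choose q hq0 hq using hex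
  have hli : LinearIndependent ℝ q :=
    Module.End.eigenvectors_linearIndependent' (Matrix.toLin' M) a ha q fun i =>
      ⟨Module.End.mem_eigenspace_iff.2 (by simpa using hq i), hq0 i⟩
  rcases isEmpty_or_nonempty n with hn | hn
  · exact ⟨q, hq, by ext i; exact hn.elim i⟩
  let b := basisOfLinearIndependentOfCardEqFinrank hli (by simp)
  refine ⟨fun i => b.repr x i • q i, fun i => ?_, ?_⟩
  · rw [Matrix.mulVec_smul, hq, smul_comm]
  · conv_lhs => rw [← b.sum_repr x]
    simp [b]

/-- For a matrix symmetric with respect to positive weights whose eigenvalues are nonnegative, a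
diagonal entry is positive unless its column vanishes. -/
theorem diag_pos_of_sum_eigenvectors {n : Type*} [Fintype n] [DecidableEq n] {M : Matrix n n ℝ}
    {m : n → ℝ} (hm : ∀ i, 0 < m i) (hM : ∀ i j, m i * M i j = m j * M j i) {a : n → ℝ}
    (ha : Function.Injective a) (ha0 : ∀ i, 0 ≤ a i) {p : n → n → ℝ}
    (hp : ∀ i, M *ᵥ p i = a i • p i) {w : n} (hw : Pi.single w 1 = ∑ i, p i)
    (hcol : M.col w ≠ 0) : 0 < M w w := by
  -- `M` is self-adjoint for this weighted inner product, so the `p i` are orthogonal.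
  let ip : (n → ℝ) → (n → ℝ) → ℝ := fun x y => ∑ k, m k * x k * y k
  have hsymm : ∀ x y, ip (M *ᵥ x) y = ip x (M *ᵥ y) := by
    intro x y
    simp only [ip, Matrix.mulVec, dotProduct, Finset.mul_sum, Finset.sum_mul]
    rw [Finset.sum_comm]
    refine Finset.sum_congr rfl fun i _ => Finset.sum_congr rfl fun j _ => ?_
    linear_combination x i * y j * hM j i
  have hsmul : ∀ (c : ℝ) x y, ip (c • x) y = c * ip x y := by
    intro c x y
    simp only [ip, Finset.mul_sum, Pi.smul_apply, smul_eq_mul]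
    exact Finset.sum_congr rfl fun i _ => by ring
  have hsmul' : ∀ (c : ℝ) x y, ip x (c • y) = c * ip x y := by
    intro c x y
    simp only [ip, Finset.mul_sum, Pi.smul_apply, smul_eq_mul]
    exact Finset.sum_congr rfl fun i _ => by ring
  have horth : ∀ i j, i ≠ j → ip (p i) (p j) = 0 := by
    intro i j hij
    have h := hsymm (p i) (p j)
    rw [hp, hp, hsmul, hsmul'] at h
    have h2 : (a i - a j) * ip (p i) (p j) = 0 := by linarith
    exact (mul_eq_zero.1 h2).resolve_left (sub_ne_zero.2 (ha.ne hij))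
  have hMw : M *ᵥ Pi.single w 1 = ∑ i, a i • p i := by
    rw [hw, Matrix.mulVec_sum]
    exact Finset.sum_congr rfl fun i _ => hp i
  have hnonneg : ∀ i, 0 ≤ ip (p i) (p i) := fun i =>
    Finset.sum_nonneg fun k _ => by
      rw [mul_assoc]; exact mul_nonneg (hm k).le (mul_self_nonneg _)
  have hval : m w * M w w = ∑ i, a i * ip (p i) (p i) := by
    have h1 : m w * M w w = ip (Pi.single w 1) (M *ᵥ Pi.single w 1) := by
      simp only [ip]
      rw [Finset.sum_eq_single w]
      · simp
      · intro b _ hb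
        simp [hb]
      · simp
    have h2 : ∀ y : n → ℝ, ip (∑ i, p i) y = ∑ i, ip (p i) y := by
      intro y
      simp only [ip, Finset.sum_apply, Finset.mul_sum, Finset.sum_mul]
      rw [Finset.sum_comm]
    have h3 : ∀ (x : n → ℝ), ip x (∑ i, a i • p i) = ∑ i, a i * ip x (p i) := by
      intro x
      simp only [← hsmul', ip, Finset.sum_apply, Finset.mul_sum]
      rw [Finset.sum_comm]
    rw [h1, hMw, hw, h2]
    refine Finset.sum_congr rfl fun i _ => ?_
    rw [h3, Finset.sum_eq_single i]
    · intro j _ hj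
      rw [horth i j hj.symm, mul_zero]
    · simp
  have hterm : ∀ i, 0 ≤ a i * ip (p i) (p i) := fun i => mul_nonneg (ha0 i) (hnonneg i)
  have hge : 0 ≤ m w * M w w := hval ▸ Finset.sum_nonneg fun i _ => hterm i
  -- If the sum vanishes, every `a i • p i` does, and these add up to column `w`.
  have hne : m w * M w w ≠ 0 := by
    intro h0
    rw [hval, Finset.sum_eq_zero_iff_of_nonneg fun i _ => hterm i] at h0
    apply hcol
    rw [← Matrix.mulVec_single_one, hMw]
    refine Finset.sum_eq_zero fun i hi => ?_
    rcases mul_eq_zero.1 (h0 i hi) with h | h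
    · rw [h, zero_smul]
    · have h5 : p i = 0 := by
        ext k
        have h4 := (Finset.sum_eq_zero_iff_of_nonneg fun k _ => by
          rw [mul_assoc]; exact mul_nonneg (hm k).le (mul_self_nonneg _)).1 h k (Finset.mem_univ k)
        simpa [(hm k).ne'] using h4
      rw [h5, smul_zero]
  exact pos_of_mul_pos_right (lt_of_le_of_ne hge hne.symm) (hm w).le

/-- A weighted-symmetric `B` with zero diagonal entry and nonzero column at `w` can be scaled by
`ε > 0` and given a diagonal `d` so that `e_w` is a sum of eigenvectors with integer eigenvalues
while the diagonal entry at `w` is the reciprocal of an even integer. -/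
theorem exists_diagonal_integral_spectrum {n : Type*} [Fintype n] [DecidableEq n]
    (B : Matrix n n ℝ) {m : n → ℝ} (hm : ∀ i, 0 < m i)
    (hB : ∀ i j, m i * B i j = m j * B j i) {w : n} (hBw : B w w = 0) (hcol : B.col w ≠ 0) :
    ∃ ε : ℝ, 0 < ε ∧ ∃ (d : n → ℝ) (k : ℕ) (a : n → ℕ) (p : n → n → ℝ), 0 < k ∧
      d w = 1 / (2 * k) ∧ (∀ i, (Matrix.diagonal d + ε • B) *ᵥ p i = (a i : ℝ) • p i) ∧
      Pi.single w 1 = ∑ i, p i := by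
  -- The least eigenvalue `0` is placed at `w`, so the entry at `w` starts at `0`.
  obtain ⟨c, hc, hcw⟩ : ∃ c : n → ℕ, Function.Injective c ∧ c w = 0 := by
    have : Nonempty n := ⟨w⟩
    let f := Fintype.equivFin n
    have h0 : 0 < Fintype.card n := Fintype.card_pos
    refine ⟨fun i => (Equiv.swap (f w) ⟨0, h0⟩ (f i) : Fin _), ?_, by simp⟩
    exact Fin.val_injective.comp ((Equiv.injective _).comp f.injective)
  have ha : Function.Injective fun i => (c i : ℝ) := Nat.cast_injective.comp hc
  obtain ⟨δ, hδ, ψ, hψ, hψ0, hdet⟩ := exists_diagonal_prescribed_eigenvalues B ha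
  have hpos : 0 < ψ δ w := by
    obtain ⟨p, hp, hw⟩ := exists_sum_eigenvectors _ ha (hdet δ ⟨hδ.le, le_rfl⟩) (Pi.single w 1)
    have h := diag_pos_of_sum_eigenvectors hm (M := Matrix.diagonal (ψ δ) + δ • B) ?_ ha
      (fun i => Nat.cast_nonneg _) hp hw ?_
    · simpa [hBw] using h
    · intro i j
      rcases eq_or_ne i j with rfl | hij
      · rfl
      · simp only [Matrix.add_apply, Matrix.diagonal_apply_ne _ hij,
          Matrix.diagonal_apply_ne _ hij.symm, Matrix.smul_apply, smul_eq_mul]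
        linear_combination δ * hB i j
    · intro h0
      apply hcol
      ext j
      rcases eq_or_ne j w with rfl | hj
      · exact hBw
      · have := congrFun h0 j
        simpa [Matrix.diagonal_apply_ne _ hj, hδ.ne'] using this
  obtain ⟨k, hk⟩ := exists_nat_one_div_lt hpos
  have hk1 : (0 : ℝ) < (k + 1 : ℕ) := by positivity
  have hmem : (1 / (2 * (k + 1 : ℕ)) : ℝ) ∈ Set.Icc (ψ 0 w) (ψ δ w) := by
    rw [hψ0]
    refine ⟨by change (c w : ℝ) ≤ _; rw [hcw, Nat.cast_zero]; positivity, le_trans ?_ hk.le⟩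
    rw [← Nat.cast_add_one]
    exact one_div_le_one_div_of_le hk1 (by linarith)
  have hcont : ContinuousOn (fun ε => ψ ε w) (Set.Icc 0 δ) :=
    (continuous_apply w).comp_continuousOn hψ
  obtain ⟨ε, hε, hεw⟩ := intermediate_value_Icc hδ.le hcont hmem
  obtain ⟨p, hp, hw⟩ := exists_sum_eigenvectors _ ha (hdet ε hε) (Pi.single w 1)
  refine ⟨ε, lt_of_le_of_ne hε.1 ?_, ψ ε, k + 1, c, p, k.succ_pos, hεw, hp, hw⟩
  rintro rfl
  have h0 : ψ 0 w = 0 := by rw [hψ0]; simp [hcw]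
  have hεw' : ψ 0 w = 1 / (2 * (k + 1 : ℕ)) := hεw
  rw [h0] at hεw'
  have : (0 : ℝ) < 1 / (2 * (k + 1 : ℕ)) := by positivity
  linarith

/-! ### Evolution by phases -/

/-- A finite sum of eigenvectors evolves by phases. -/
theorem isSchrodingerSolution_sum_eigenvectors {V ι : Type*} [Fintype V] [DecidableEq V]
    [Fintype ι] (G : SimpleGraph V) [DecidableRel G.Adj] (Q : V → ℝ) (μ : ι → ℝ) (p : ι → V → ℂ)
    (hp : ∀ i, hamiltonian G Q *ᵥ p i = (μ i : ℂ) • p i) :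
    IsSchrodingerSolution G Q fun t => ∑ i, Complex.exp (Complex.I * μ i * t) • p i := by
  intro t
  have h : ∀ i ∈ (Finset.univ : Finset ι),
      HasDerivAt (fun t : ℝ => Complex.exp (Complex.I * μ i * t) • p i)
        ((Complex.exp (Complex.I * μ i * t) * (Complex.I * μ i)) • p i) t := by
    intro i _
    have h1 : HasDerivAt (fun t : ℝ => Complex.I * μ i * t) (Complex.I * μ i) t := by
      simpa using (Complex.ofRealCLM.hasDerivAt (x := t)).const_mul (Complex.I * μ i)
    exact h1.cexp.smul_const (p i)
  refine (HasDerivAt.fun_sum h).congr_deriv ?_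
  rw [Matrix.mulVec_sum, Finset.smul_sum]
  refine Finset.sum_congr rfl fun i _ => ?_
  rw [Matrix.mulVec_smul, hp, smul_smul, smul_smul]
  congr 1
  ring

/-- Transfer occurs from `u` to `v` at time `T` when the phase is `1` on a spectral decomposition
of `e_u + e_v` and `-1` on `e_u - e_v`. -/
theorem perfectStateTransfer_of_phases {V ι : Type*} [Fintype V] [DecidableEq V] [Fintype ι]
    (G : SimpleGraph V) [DecidableRel G.Adj] (Q : V → ℝ) {u v : V} {μ : ι → ℝ} {ν : ℝ}
    {p : ι → V → ℂ} (hp : ∀ i, hamiltonian G Q *ᵥ p i = (μ i : ℂ) • p i)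
    (hsum : Pi.single u 1 + Pi.single v 1 = ∑ i, p i)
    (hν : hamiltonian G Q *ᵥ (Pi.single u 1 - Pi.single v 1) =
      (ν : ℂ) • (Pi.single u 1 - Pi.single v 1))
    {T : ℝ} (hT : 0 ≤ T) (hμT : ∀ i, Complex.exp (Complex.I * μ i * T) = 1)
    (hνT : Complex.exp (Complex.I * ν * T) = -1) : PerfectStateTransfer G Q u v := by
  -- The index `none` carries the antisymmetric half of `e_u`.
  let q : Option ι → V → ℂ := fun o =>
    o.elim ((1 / 2 : ℂ) • (Pi.single u 1 - Pi.single v 1)) fun i => (1 / 2 : ℂ) • p i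
  let μ' : Option ι → ℝ := fun o => o.elim ν μ
  have hq : ∀ o, hamiltonian G Q *ᵥ q o = (μ' o : ℂ) • q o := by
    rintro (_ | i)
    · simp only [q, μ', Option.elim_none, Matrix.mulVec_smul, hν, smul_comm (ν : ℂ)]
    · simp only [q, μ', Option.elim_some, Matrix.mulVec_smul, hp, smul_comm (μ i : ℂ)]
  refine ⟨_, isSchrodingerSolution_sum_eigenvectors G Q μ' q hq, ?_, T, hT, ?_⟩
  · simp only [Complex.ofReal_zero, mul_zero, Complex.exp_zero, one_smul, Fintype.sum_option, q,
      Option.elim_none, Option.elim_some, ← Finset.smul_sum, ← hsum]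
    module
  · have hfin : ∑ o, Complex.exp (Complex.I * μ' o * T) • q o = Pi.single v 1 := by
      simp only [Fintype.sum_option, q, μ', Option.elim_none, Option.elim_some, hμT, hνT,
        one_smul, ← Finset.smul_sum, ← hsum]
      module
    simp only [hfin]
    exact ⟨by simp, fun x hx => by simp [hx]⟩

/-! ### The twin quotient and the choice of potential -/

/-- The quotient of the adjacency matrix by the identification of the twin `v` with `u`. -/
noncomputable def twinQuotient {V : Type*} [DecidableEq V] (G : SimpleGraph V)
    [DecidableRel G.Adj] (u v : V) : Matrix {x // x ≠ v} {x // x ≠ v} ℝ :=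
  fun x y => G.adjMatrix ℝ x y * if (y : V) = u then 2 else 1

/-- The retraction of the vertex set that sends `v` to its twin `u`. -/
def twinRetract {V : Type*} [DecidableEq V] {u v : V} (huv : u ≠ v) (x : V) : {x // x ≠ v} :=
  if h : x = v then ⟨u, huv⟩ else ⟨x, h⟩

/-- Eigenvectors of the quotient lift to functions equal at the twins: rows `u` and `v` of the
adjacency matrix agree, and so do the two columns, whence the factor 2 in the quotient. -/
theorem adjMatrix_mulVec_comp_twinRetract {V : Type*} [Fintype V] [DecidableEq V]
    (G : SimpleGraph V) [DecidableRel G.Adj] {u v : V} (huv : u ≠ v)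
    (hnbhd : ∀ x, G.Adj u x ↔ G.Adj v x) (p : {x // x ≠ v} → ℝ) (x : V) :
    (G.adjMatrix ℝ *ᵥ (p ∘ twinRetract huv)) x =
      (twinQuotient G u v *ᵥ p) (twinRetract huv x) := by
  have hrow : ∀ y, G.adjMatrix ℝ x y = G.adjMatrix ℝ (twinRetract huv x) y := by
    intro y
    unfold twinRetract
    split_ifs with h
    · subst h
      simp only [SimpleGraph.adjMatrix_apply, hnbhd]
    · rfl
  have hcol : G.adjMatrix ℝ x v = G.adjMatrix ℝ x u := by
    simp only [SimpleGraph.adjMatrix_apply, G.adj_comm x, hnbhd]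
  have hsub : ∀ f : V → ℝ, ∑ y, f y = f v + ∑ y : {x // x ≠ v}, f y := by
    intro f
    rw [← Finset.add_sum_erase _ _ (Finset.mem_univ v)]
    congr 1
    exact (Finset.sum_subtype _ (by simp) f)
  have hr : ∀ y : {x // x ≠ v}, twinRetract huv (y : V) = y := fun y => dif_neg y.2
  have hv : twinRetract huv v = ⟨u, huv⟩ := dif_pos rfl
  simp only [Matrix.mulVec, dotProduct, twinQuotient, ← hrow]
  rw [hsub]
  simp only [Function.comp_apply, hr, hv, hcol]
  have h1 : ∀ y : {x // x ≠ v}, (G.adjMatrix ℝ x y * if (y : V) = u then 2 else 1) * p y =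
      (if y = ⟨u, huv⟩ then G.adjMatrix ℝ x u * p ⟨u, huv⟩ else 0) +
        G.adjMatrix ℝ x y * p y := by
    rintro ⟨y, hy⟩
    by_cases h : y = u
    · subst h
      simp only [if_true]
      ring
    · simp [h]
  simp only [h1, Finset.sum_add_distrib, Finset.sum_ite_eq', Finset.mem_univ, if_true]

theorem theorem2 {V : Type*} [Fintype V] [DecidableEq V] (G : SimpleGraph V)
    [DecidableRel G.Adj] (u v : V) (huv : u ≠ v) (hadj : ¬ G.Adj u v)
    (hnbhd : G.neighborSet u = G.neighborSet v) (hne : (G.neighborSet u).Nonempty) :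
    ∃ Q : V → ℝ, PerfectStateTransfer G Q u v ∧ PerfectStateTransfer G Q v u := by
  have hnb : ∀ x, G.Adj u x ↔ G.Adj v x := fun x => Set.ext_iff.1 hnbhd x
  let w : {x // x ≠ v} := ⟨u, huv⟩
  let r : V → {x // x ≠ v} := twinRetract huv
  obtain ⟨z, hz⟩ := hne
  have hzv : z ≠ v := by
    rintro rfl
    exact hadj hz
  obtain ⟨ε, hε, d, k, a, p, hk, hd, hp, hsum⟩ :=
    exists_diagonal_integral_spectrum (twinQuotient G u v)
      -- The weight is the number of vertices merged into `x`; it symmetrizes the quotient.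
      (m := fun x => if (x : V) = u then 2 else 1) (w := w)
      (fun i => by split_ifs <;> norm_num)
      (fun i j => by
        simp only [twinQuotient, SimpleGraph.adjMatrix_apply, G.adj_comm (i : V)]
        ring)
      (by simp [twinQuotient])
      (fun h => by
        have := congrFun h ⟨z, hzv⟩
        have hzu : G.Adj z u := G.adj_symm hz
        simp [twinQuotient, w, hzu] at this)
  have hk0 : (k : ℝ) ≠ 0 := by positivity
  -- Dividing `diagonal d + ε • B` by `ε` restores the unscaled adjacency part; factoring through
  -- `r` makes `Q` agree at the twins.
  let Q : V → ℝ := fun x => -(d (r x) / ε)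
  let P : {x // x ≠ v} → V → ℂ := fun i x => (p i (r x) : ℂ)
  have hru : r u = w := dif_neg huv
  have hrv : r v = w := dif_pos rfl
  have hP : ∀ i, hamiltonian G Q *ᵥ P i = ((a i / ε : ℝ) : ℂ) • P i := by
    intro i
    ext x
    have h1 := congrFun (hp i) (r x)
    rw [Matrix.add_mulVec, Pi.add_apply, Matrix.mulVec_diagonal, Matrix.smul_mulVec,
      Pi.smul_apply, ← adjMatrix_mulVec_comp_twinRetract G huv hnb] at h1
    have h2 : (G.adjMatrix ℂ *ᵥ P i) x =
        ((G.adjMatrix ℝ *ᵥ (p i ∘ twinRetract huv)) x : ℝ) := by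
      simp [Matrix.mulVec, dotProduct, P, r, SimpleGraph.adjMatrix_apply, apply_ite]
    rw [hamiltonian, Matrix.sub_mulVec, Pi.sub_apply, Matrix.mulVec_diagonal, h2]
    simp only [Pi.smul_apply, smul_eq_mul, P] at h1 ⊢
    rw [← Complex.ofReal_mul, ← Complex.ofReal_mul, ← Complex.ofReal_sub, Complex.ofReal_inj]
    simp only [Q]
    field_simp
    linarith
  have hPsum : Pi.single u 1 + Pi.single v 1 = ∑ i, P i := by
    ext x
    have h1 := congrArg (Complex.ofReal) (congrFun hsum (r x))
    rw [Finset.sum_apply, Complex.ofReal_sum] at h1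
    rw [Finset.sum_apply, ← h1]
    by_cases hxv : x = v
    · subst hxv
      simp [hrv, huv.symm]
    · by_cases hxu : x = u
      · subst hxu
        simp [hru, huv]
      · have : r x ≠ w := by
          simp [r, twinRetract, hxv, w, hxu]
        simp [hxv, hxu, this]
  have hanti : hamiltonian G Q *ᵥ (Pi.single u 1 - Pi.single v 1) =
      ((d w / ε : ℝ) : ℂ) • (Pi.single u 1 - Pi.single v 1) := by
    have h1 : G.adjMatrix ℂ *ᵥ (Pi.single u 1 - Pi.single v 1) = 0 := by
      ext x
      simp [G.adj_comm x, hnb]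
    rw [hamiltonian, Matrix.sub_mulVec, h1, zero_sub]
    ext x
    rw [Pi.neg_apply, Matrix.mulVec_diagonal, Pi.smul_apply, smul_eq_mul]
    by_cases hxv : x = v
    · subst hxv
      simp [Q, hrv]
    · by_cases hxu : x = u
      · subst hxu
        simp [Q, hru]
      · simp [hxv, hxu]
  -- At this time eigenvalue `a i / ε` has angle `2πk * a i`, and `d w / ε = 1 / (2kε)` has angle
  -- `π`.
  have hT : 0 ≤ ε * Real.pi * (2 * k) := by positivity
  have hphase : ∀ i, Complex.exp (Complex.I * ((a i / ε : ℝ) : ℂ) *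
      ((ε * Real.pi * (2 * k) : ℝ) : ℂ)) = 1 := by
    intro i
    rw [Complex.exp_eq_one_iff]
    refine ⟨a i * k, ?_⟩
    have : (ε : ℂ) ≠ 0 := by exact_mod_cast hε.ne'
    push_cast
    field_simp
  have hphase' : Complex.exp (Complex.I * ((d w / ε : ℝ) : ℂ) *
      ((ε * Real.pi * (2 * k) : ℝ) : ℂ)) = -1 := by
    rw [← Complex.exp_pi_mul_I, hd]
    congr 1
    have : (ε : ℂ) ≠ 0 := by exact_mod_cast hε.ne'
    have : (k : ℂ) ≠ 0 := by exact_mod_cast hk.ne'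
    push_cast
    field_simp
  -- Exchanging `u` and `v` only negates the antisymmetric eigenvector.
  refine ⟨Q, perfectStateTransfer_of_phases G Q hP hPsum hanti hT hphase hphase',
    perfectStateTransfer_of_phases G Q hP (by rw [add_comm, hPsum]) ?_ hT hphase hphase'⟩
  rw [← neg_sub (Pi.single u 1) (Pi.single v 1), Matrix.mulVec_neg, hanti, smul_neg]
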